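/- All graphs are finite and simple, and $e(G)$ and $\Delta(G)$ denote the number of edges and the maximum degree of $G$. For a nonempty set $S\subseteq V(G)$ the Steiner distance $d_G(S)$ is the minimum number of edges of a connected subgraph of $G$ whose vertex set contains $S$ (and $\infty$ if there is none). For $1\le k\le |V(G)|$ the Steiner $k$-eccentricity of a vertex $v$ is $e_k(v)=\max\{d_G(S) : v\in S\subseteq V(G),\ |S|=k\}$, and the Steiner $k$-diameter is $\mathrm{sdiam}_k(G)=\max_{v\in V(G)} e_k(v)$. Let $$e_k(n,\ell,d)=\min\{e(G) : |V(G)|=n,\ \Delta(G)=\ell,\ \mathrm{sdiam}_k(G)\le d\},$$ with $e_k(n,\ell,d)=\infty$ if there is no such graph. **Theorem** (the case $k=n-2$). (1) For $2\le \ell\le n-1$, $e_{n-2}(n,\ell,n-1)=n-1$. (2) For $n\ge 5$, $e_{n-2}(n,\ell,n-2)=n$ if $2\le \ell\le n-2$, and $e_{n-2}(n,\ell,n-2)=n-1$ if $\ell=n-1$. (3) For $i\in\{0,1\}$: - $e_{n-2}(n,n-1-i,n-3)=2n-2$ for $n\ge 5+i$; - $e_{n-2}(n,n-3-i,n-3)=2n-3$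 for $n\ge 7+2i$; - $e_{n-2}(n,n-5-i,n-3)=2n-4$ for $n\ge 11+2i$; - $e_{n-2}(n,n-7-i,n-3)=2n-5$ for $n\ge 15+2i$. For $6\le \ell\le n-9$, let $r\ge 1$ and $s\in\{2,3,4,5\}$ be the unique integers with $4r+\ell+s+3=n$. Then $e_{n-2}(n,\ell,n-3)$ is finite and $$\tfrac12(3n+\ell-3)\ \le\ e_{n-2}(n,\ell,n-3)\ \le\ \tfrac12(3n+\ell+s-5),$$ and if $s=2$, then $e_{n-2}(n,\ell,n-3)=\tfrac12(3n+\ell-3)$. -/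

import Mathlib

/-- The Steiner distance of a vertex set `S` in `G`: the minimum number of edges of a connected
subgraph of `G` whose vertex set contains `S` (`⊤` if there is no such subgraph). -/
noncomputable def SimpleGraph.steinerDist {V : Type*} (G : SimpleGraph V) (S : Set V) : ℕ∞ :=
  ⨅ (H : G.Subgraph) (_ : H.Connected) (_ : S ⊆ H.verts), H.edgeSet.encard

/-- The Steiner `k`-eccentricity of `v`: the maximum Steiner distance of a `k`-element vertex set
containing `v`. -/
noncomputable def SimpleGraph.steinerEcc {V : Type*} (G : SimpleGraph V) (k : ℕ) (v : V) : ℕ∞ :=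
  ⨆ (S : Finset V) (_ : S.card = k) (_ : v ∈ S), G.steinerDist (S : Set V)

/-- The Steiner `k`-diameter `sdiam_k(G)`: the maximum Steiner `k`-eccentricity of a vertex. -/
noncomputable def SimpleGraph.steinerDiam {V : Type*} (G : SimpleGraph V) (k : ℕ) : ℕ∞ :=
  ⨆ v : V, G.steinerEcc k v

open Classical in
/-- The class `H_k(n, ℓ, d)` of graphs of order `n` with maximum degree (exactly) `ℓ` and
Steiner `k`-diameter at most `d`. -/
def steinerClass (k n ℓ d : ℕ) : Set (SimpleGraph (Fin n)) :=
  {G | G.maxDegree = ℓ ∧ G.steinerDiam k ≤ (d : ℕ∞)}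

/-- `e_k(n, ℓ, d)`: the minimum number of edges of a graph in `H_k(n, ℓ, d)`
(`⊤` if the class is empty). -/
noncomputable def minSteinerSize (k n ℓ d : ℕ) : ℕ∞ :=
  ⨅ G ∈ steinerClass k n ℓ d, G.edgeSet.encard

/-! ### Steiner distance via connected subgraphs -/

namespace SimpleGraph

variable {V : Type*} {G : SimpleGraph V}

/-! For `k = n - 2` the set `S` omits just two vertices, so a bound on the Steiner diameter is a
statement about deleting vertices. Bound `n - 1` asks for connectedness (`n ≥ 4`); a broom attains
the tree bound.

Bound `n - 2` forces one of any two deleted vertices to be dispensable. A tree with maximum degree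
at most `n - 2` has two vertices of degree at least 2, neither dispensable, so at least `n` edges
are needed; a broom whose handle is closed into a cycle has exactly `n`.

Bound `n - 3` says that the graph stays connected when any two vertices are deleted. Then all
degrees are at least 3, and one degree `ℓ` gives `2e ≥ 3(n - 1) + ℓ`. `hubGraph` attains this up to
parity: `ℓ` rim vertices of a cycle see a hub, and chords pair up the others. Hence
`minSteinerSize_sub_three` gives the exact value for all `4 ≤ ℓ ≤ n - 1`, and every claim in (3) is
arithmetic on that formula. -/

theorem steinerDist_le_iff {S : Set V} {d : ℕ} :
    G.steinerDist S ≤ d ↔ ∃ H : G.Subgraph, H.Connected ∧ S ⊆ H.verts ∧ H.edgeSet.encard ≤ d := by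
  -- A strict bound on an infimum yields a witness, so `≤ d` is turned into `< d + 1`.
  rw [← ENat.lt_add_one_iff (ENat.natCast_ne_top d), steinerDist]
  simp only [iInf_lt_iff]
  simp only [ENat.lt_add_one_iff (ENat.natCast_ne_top d), exists_prop]

theorem steinerDiam_le_iff {k : ℕ} (hk : k ≠ 0) {d : ℕ∞} :
    G.steinerDiam k ≤ d ↔ ∀ S : Finset V, S.card = k → G.steinerDist (S : Set V) ≤ d := by
  simp only [steinerDiam, steinerEcc, iSup_le_iff]
  refine ⟨fun h S hS => ?_, fun h v S hS _ => h S hS⟩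
  obtain ⟨v, hv⟩ := Finset.card_pos.1 (by omega : 0 < S.card)
  exact h v S hS hv

theorem Subgraph.Connected.ncard_verts_le [Finite V] {H : G.Subgraph} (h : H.Connected) :
    H.verts.ncard ≤ H.edgeSet.ncard + 1 := by
  have := h.coe.card_vert_le_card_edgeSet_add_one
  rw [← H.image_coe_edgeSet_coe,
    Set.ncard_image_of_injective _ (Sym2.map.injective Subtype.val_injective)]
  exact this

/-- A connected induced subgraph has a spanning tree, viewed as a subgraph of the whole graph. -/
theorem exists_connected_subgraph_of_induce [Finite V] {s : Set V} (h : (G.induce s).Connected) :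
    ∃ H : G.Subgraph, H.Connected ∧ H.verts = s ∧ H.edgeSet.ncard + 1 = s.ncard := by
  obtain ⟨T, hle, hT⟩ := h.exists_isTree_le
  let H : G.Subgraph :=
    { verts := s
      Adj := fun a b => ∃ (ha : a ∈ s) (hb : b ∈ s), T.Adj ⟨a, ha⟩ ⟨b, hb⟩
      adj_sub := fun ⟨_, _, h⟩ => hle h
      edge_vert := fun ⟨ha, _, _⟩ => ha
      symm := ⟨fun _ _ ⟨ha, hb, h⟩ => ⟨hb, ha, h.symm⟩⟩ }
  have hH : H.coe = T := by
    ext ⟨a, ha⟩ ⟨b, hb⟩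
    exact ⟨fun ⟨_, _, h⟩ => h, fun h => ⟨ha, hb, h⟩⟩
  refine ⟨H, ⟨?_⟩, rfl, ?_⟩
  · rw [hH]; exact hT.connected
  · rw [← H.image_coe_edgeSet_coe,
      Set.ncard_image_of_injective _ (Sym2.map.injective Subtype.val_injective), hH]
    exact (isTree_iff_connected_and_card.1 hT).2

theorem steinerDist_le_of_induce_connected [Finite V] {S s : Set V} (hS : S ⊆ s)
    (h : (G.induce s).Connected) {d : ℕ} (hd : s.ncard ≤ d + 1) : G.steinerDist S ≤ d := by
  obtain ⟨H, hc, rfl, he⟩ := exists_connected_subgraph_of_induce h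
  refine steinerDist_le_iff.2 ⟨H, hc, hS, ?_⟩
  rw [← Set.Finite.cast_ncard_eq (Set.toFinite _)]
  exact_mod_cast (by omega : H.edgeSet.ncard ≤ d)

open Classical in
theorem sum_ncard_neighborSet [Fintype V] :
    ∑ v, (G.neighborSet v).ncard = 2 * G.edgeSet.ncard := by
  rw [← coe_edgeFinset, Set.ncard_coe_finset, ← sum_degrees_eq_twice_card_edges]
  refine Finset.sum_congr rfl fun v _ => ?_
  rw [Set.ncard_eq_toFinset_card', ← card_neighborFinset_eq_degree]; rfl

end SimpleGraph

open SimpleGraph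

/-! ### Counting edges and degrees; reachability in induced subgraphs -/

section SteinerClass

variable {n : ℕ}

theorem mem_steinerClass_iff {k ℓ d : ℕ} [NeZero n] {G : SimpleGraph (Fin n)} :
    G ∈ steinerClass k n ℓ d ↔ ((∀ v, (G.neighborSet v).ncard ≤ ℓ) ∧
      ∃ v, (G.neighborSet v).ncard = ℓ) ∧ G.steinerDiam k ≤ d := by
  classical
  have key : ∀ v, (G.neighborSet v).ncard = G.degree v := fun v => by
    rw [Set.ncard_eq_toFinset_card', ← card_neighborFinset_eq_degree]; rfl
  simp only [steinerClass, Set.mem_ofPred_eq, key]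
  refine and_congr_left fun _ => ⟨?_, ?_⟩
  · intro h
    obtain ⟨v, hv⟩ := G.exists_maximal_degree_vertex
    have hv' : G.degree v = ℓ := by rw [← hv, ← h]
    refine ⟨fun w => ?_, v, hv'⟩
    have := G.degree_le_maxDegree w
    omega
  · rintro ⟨h, v, hv⟩
    have h1 : G.maxDegree = ℓ :=
      le_antisymm (G.maxDegree_le_of_forall_degree_le _ h) (hv ▸ G.degree_le_maxDegree v)
    rw [← h1]

theorem minSteinerSize_eq {k ℓ d m : ℕ} (G : SimpleGraph (Fin n)) (hG : G ∈ steinerClass k n ℓ d)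
    (hm : G.edgeSet.ncard ≤ m)
    (h : ∀ G ∈ steinerClass k n ℓ d, m ≤ G.edgeSet.ncard) : minSteinerSize k n ℓ d = m := by
  refine le_antisymm (iInf₂_le_of_le G hG ?_) (le_iInf₂ fun G hG => ?_)
  · rw [← Set.Finite.cast_ncard_eq (Set.toFinite _)]
    exact_mod_cast hm
  · rw [← Set.Finite.cast_ncard_eq (Set.toFinite _)]
    exact_mod_cast h G hG

/-- Bounding the number of edges by listing the pairs of endpoints. -/
theorem ncard_edgeSet_le {G : SimpleGraph (Fin n)} (F : Finset (ℕ × ℕ))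
    (h : ∀ a b, G.Adj a b → ((a : ℕ), (b : ℕ)) ∈ F ∨ ((b : ℕ), (a : ℕ)) ∈ F) :
    G.edgeSet.ncard ≤ F.card := by
  classical
  rw [← Set.ncard_image_of_injective G.edgeSet (Sym2.map.injective Fin.val_injective)]
  refine le_trans (Set.ncard_le_ncard (t := (F.image fun p => s(p.1, p.2) : Finset (Sym2 ℕ))) ?_)
    ((Set.ncard_coe_finset _).le.trans Finset.card_image_le)
  rintro _ ⟨e, he, rfl⟩
  induction e with
  | _ a b =>
    rw [Finset.coe_image]
    rcases h a b he with h | h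
    · exact ⟨_, h, rfl⟩
    · exact ⟨_, h, Sym2.eq_swap⟩

theorem ncard_neighborSet_le {G : SimpleGraph (Fin n)} {v : Fin n} (F : Finset ℕ)
    (h : ∀ w, G.Adj v w → (w : ℕ) ∈ F) : (G.neighborSet v).ncard ≤ F.card := by
  rw [← Set.ncard_image_of_injective _ Fin.val_injective, ← Set.ncard_coe_finset]
  refine Set.ncard_le_ncard ?_
  rintro _ ⟨w, hw, rfl⟩
  exact h w hw

theorem ncard_neighborSet_eq {G : SimpleGraph (Fin n)} {v : Fin n} (F : Finset ℕ)
    (hF : ∀ w ∈ F, w < n) (h : ∀ w, G.Adj v w ↔ (w : ℕ) ∈ F) :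
    (G.neighborSet v).ncard = F.card := by
  rw [← Set.ncard_image_of_injective _ Fin.val_injective, ← Set.ncard_coe_finset]
  congr 1
  ext w
  exact ⟨fun ⟨u, hu, e⟩ => e ▸ (h u).1 hu, fun hw => ⟨⟨w, hF w hw⟩, (h _).2 hw, rfl⟩⟩

/-- Two vertices, named by natural numbers, are joined inside the induced subgraph on `s`. -/
def ReachIn (G : SimpleGraph (Fin n)) (s : Set (Fin n)) (a b : ℕ) : Prop :=
  ∃ (ha : ∃ h : a < n, ⟨a, h⟩ ∈ s) (hb : ∃ h : b < n, ⟨b, h⟩ ∈ s),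
    (G.induce s).Reachable ⟨⟨a, ha.1⟩, ha.2⟩ ⟨⟨b, hb.1⟩, hb.2⟩

namespace ReachIn

variable {G : SimpleGraph (Fin n)} {s : Set (Fin n)} {a b c : ℕ}

theorem refl (ha : ∃ h : a < n, ⟨a, h⟩ ∈ s) : ReachIn G s a a := ⟨ha, ha, .refl _⟩

theorem symm : ReachIn G s a b → ReachIn G s b a := fun ⟨h, h', r⟩ => ⟨h', h, r.symm⟩

theorem trans : ReachIn G s a b → ReachIn G s b c → ReachIn G s a c :=
  fun ⟨h, _, r⟩ ⟨_, h', r'⟩ => ⟨h, h', r.trans r'⟩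

theorem of_adj (ha : ∃ h : a < n, ⟨a, h⟩ ∈ s) (hb : ∃ h : b < n, ⟨b, h⟩ ∈ s)
    (h : G.Adj ⟨a, ha.1⟩ ⟨b, hb.1⟩) : ReachIn G s a b :=
  ⟨ha, hb, Adj.reachable (G := G.induce s) (u := ⟨_, ha.2⟩) (v := ⟨_, hb.2⟩) h⟩

theorem of_interval (hab : a ≤ b) (hs : ∀ i, a ≤ i → i ≤ b → ∃ h : i < n, ⟨i, h⟩ ∈ s)
    (hG : ∀ i (h : i + 1 < n), a ≤ i → i < b → G.Adj ⟨i, by omega⟩ ⟨i + 1, h⟩) :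
    ReachIn G s a b := by
  induction b, hab using Nat.le_induction with
  | base => exact refl (hs a le_rfl le_rfl)
  | succ b hab ih =>
    exact (ih (fun i h h' => hs i h (by omega)) fun i h h' h'' => hG i h h' (by omega)).trans
      (of_adj (hs b hab (by omega)) (hs (b + 1) (by omega) le_rfl)
        (hG b (hs (b + 1) (by omega) le_rfl).1 hab (by omega)))

theorem connected (r : ℕ) (hr : ∃ h : r < n, ⟨r, h⟩ ∈ s)
    (h : ∀ u : Fin n, u ∈ s → ReachIn G s u r) : (G.induce s).Connected := by
  rw [connected_iff_exists_forall_reachable]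
  exact ⟨⟨⟨r, hr.1⟩, hr.2⟩, fun ⟨u, hu⟩ => (h u hu).2.2.symm⟩

end ReachIn

end SteinerClass

/-! ### Lower bounds on the number of edges -/

section LowerBounds

variable {n : ℕ}

/-- A graph of finite Steiner `(n - 2)`-diameter on at least four vertices is connected. -/
theorem connected_of_steinerDiam_le {d : ℕ} (hn : 4 ≤ n) {G : SimpleGraph (Fin n)}
    (h : G.steinerDiam (n - 2) ≤ d) : G.Connected := by
  rw [steinerDiam_le_iff (by omega)] at h
  have : Nonempty (Fin n) := ⟨⟨0, by omega⟩⟩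
  refine ⟨fun u v => ?_⟩
  obtain ⟨S, hS, hSc⟩ := Finset.exists_superset_card_eq (s := {u, v}) (n := n - 2)
    (Finset.card_le_two.trans (by omega)) (by simp)
  obtain ⟨H, hH, hSH, -⟩ := steinerDist_le_iff.1 (h S hSc)
  exact (hH.coe ⟨u, hSH (hS (by simp))⟩ ⟨v, hSH (hS (by simp))⟩).map H.hom

theorem SimpleGraph.Connected.le_ncard_edgeSet {G : SimpleGraph (Fin n)} (h : G.Connected) :
    n - 1 ≤ G.edgeSet.ncard := by
  have := h.card_vert_le_card_edgeSet_add_one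
  rw [Nat.card_fin, Nat.card_coe_set_eq] at this
  omega

/-- Removing any two vertices of a graph with Steiner `(n - 2)`-diameter at most `d` leaves the
vertices of a connected subgraph with at most `d` edges. -/
theorem exists_connected_subgraph_avoiding {d : ℕ} (hn : 3 ≤ n) {G : SimpleGraph (Fin n)}
    (h : G.steinerDiam (n - 2) ≤ d) {x y : Fin n} (hxy : x ≠ y) :
    ∃ H : G.Subgraph, H.Connected ∧ (∀ v, v ≠ x → v ≠ y → v ∈ H.verts) ∧
      H.edgeSet.ncard ≤ d := by
  rw [steinerDiam_le_iff (by omega)] at h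
  obtain ⟨H, hH, hS, hd⟩ := steinerDist_le_iff.1 (h {x, y}ᶜ (by
    rw [Finset.card_compl, Finset.card_pair hxy, Fintype.card_fin]))
  rw [← Set.Finite.cast_ncard_eq (Set.toFinite _)] at hd
  refine ⟨H, hH, fun v hx hy => hS (by simp [hx, hy]), by exact_mod_cast hd⟩

/-- Deleting two vertices that include all neighbours of `v` would isolate `v` from the other
survivors. -/
theorem three_le_ncard_neighborSet (hn : 5 ≤ n) {G : SimpleGraph (Fin n)}
    (h : G.steinerDiam (n - 2) ≤ (n - 3 : ℕ)) (v : Fin n) : 3 ≤ (G.neighborSet v).ncard := by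
  classical
  by_contra! hlt
  obtain ⟨S, hS, hSc⟩ := Finset.exists_subsuperset_card_eq (s := (G.neighborSet v).toFinset)
    (t := {v}ᶜ) (n := 2) (by intro w hw; simp at hw ⊢; exact hw.ne')
    (by rw [← Set.ncard_eq_toFinset_card']; omega)
    (by rw [Finset.card_compl, Fintype.card_fin, Finset.card_singleton]; omega)
  obtain ⟨hSv, hS2⟩ := hSc
  obtain ⟨x, y, hxy, rfl⟩ := Finset.card_eq_two.1 hS2
  obtain ⟨H, hH, hSH, hd⟩ := exists_connected_subgraph_avoiding (by omega) h hxy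
  have hvx : v ≠ x := by rintro rfl; simpa using hSv (Finset.mem_insert_self _ _)
  have hvy : v ≠ y := by
    rintro rfl; simpa using hSv (Finset.mem_insert_of_mem (Finset.mem_singleton_self _))
  have hcard := hH.ncard_verts_le
  -- With at most `n - 3` edges, `H` has at most `n - 2` vertices, so it has no room for `x` or `y`.
  have hverts : H.verts = {x, y}ᶜ := by
    refine (Set.eq_of_subset_of_ncard_le (fun w hw => ?_) ?_).symm
    · simp at hw; exact hSH w hw.1 hw.2
    · rw [Set.ncard_compl, Set.ncard_pair hxy, Nat.card_fin]; omega
  have hv : v ∈ H.verts := hSH v hvx hvy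
  obtain ⟨w, hw⟩ : ∃ w, w ∉ ({x, y, v} : Finset (Fin n)) := by
    by_contra! hall
    have := Finset.card_le_card (fun w _ => hall w : Finset.univ ⊆ ({x, y, v} : Finset (Fin n)))
    have h3 := Finset.card_le_three (a := x) (b := y) (c := v)
    rw [Finset.card_univ, Fintype.card_fin] at this
    omega
  simp only [Finset.mem_insert, Finset.mem_singleton, not_or] at hw
  obtain ⟨u, hu⟩ := (hH.coe.preconnected ⟨v, hv⟩ ⟨w, hSH w hw.1 hw.2.1⟩).exists_isPath
  cases u with
  | nil => exact hw.2.2 rfl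
  | @cons _ z _ hz _ =>
    have hz1 := hverts.subset z.2
    have hz3 : z.1 ∈ ({x, y} : Finset (Fin n)) := hS (by simpa using H.adj_sub hz)
    simp at hz1 hz3
    tauto

theorem le_two_mul_ncard_edgeSet {G : SimpleGraph (Fin n)} (h : ∀ v, 3 ≤ (G.neighborSet v).ncard)
    (v : Fin n) : 3 * (n - 1) + (G.neighborSet v).ncard ≤ 2 * G.edgeSet.ncard := by
  rw [← sum_ncard_neighborSet, ← Finset.add_sum_erase _ _ (Finset.mem_univ v), add_comm]
  gcongr
  have := Finset.card_nsmul_le_sum (Finset.univ.erase v) _ 3 fun w _ => h w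
  rw [Finset.card_erase_of_mem (Finset.mem_univ v), Finset.card_univ, Fintype.card_fin] at this
  simpa [mul_comm] using this

theorem ncard_edgeSet_add_le_of_notMem {G : SimpleGraph (Fin n)} (H : G.Subgraph) {x : Fin n}
    (hx : x ∉ H.verts) : H.edgeSet.ncard + (G.neighborSet x).ncard ≤ G.edgeSet.ncard := by
  have hinj : (G.incidenceSet x).ncard = (G.neighborSet x).ncard := by
    classical
    exact Nat.card_congr (G.incidenceSetEquivNeighborSet x)
  rw [← hinj, ← Set.ncard_union_eq]
  · exact Set.ncard_le_ncard (Set.union_subset H.edgeSet_subset (G.incidenceSet_subset x))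
  · exact Set.disjoint_left.2 fun e he hx' =>
      hx (H.mem_verts_of_mem_edge he hx'.2)

/-- The `+ 1` pays for a possible edge `xy`, which both degrees count. -/
theorem ncard_edgeSet_add_le_of_notMem_two {G : SimpleGraph (Fin n)} (H : G.Subgraph) {x y : Fin n}
    (hxy : x ≠ y) (hx : x ∉ H.verts) (hy : y ∉ H.verts) :
    H.edgeSet.ncard + (G.neighborSet x).ncard + (G.neighborSet y).ncard ≤
      G.edgeSet.ncard + 1 := by
  have hinj : ∀ x, (G.incidenceSet x).ncard = (G.neighborSet x).ncard := fun x => by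
    classical
    exact Nat.card_congr (G.incidenceSetEquivNeighborSet x)
  have h1 : (G.incidenceSet x ∪ G.incidenceSet y).ncard + 1 ≥
      (G.neighborSet x).ncard + (G.neighborSet y).ncard := by
    rw [← hinj, ← hinj, ← Set.ncard_union_add_ncard_inter]
    gcongr
    refine (Set.ncard_le_ncard (G.incidenceSet_inter_incidenceSet_subset hxy)).trans ?_
    simp
  have h2 : H.edgeSet.ncard + (G.incidenceSet x ∪ G.incidenceSet y).ncard ≤ G.edgeSet.ncard := by
    rw [← Set.ncard_union_eq]
    · exact Set.ncard_le_ncard (Set.union_subset H.edgeSet_subset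
        (Set.union_subset (G.incidenceSet_subset x) (G.incidenceSet_subset y)))
    · refine Set.disjoint_left.2 fun e he h => ?_
      rcases h with h | h
      · exact hx (H.mem_verts_of_mem_edge he h.2)
      · exact hy (H.mem_verts_of_mem_edge he h.2)
  omega

/-- A connected subgraph that avoids one of two vertices of degree at least 2 leaves too many edges
outside it for `G` to have only `n - 1`. -/
theorem le_ncard_edgeSet_of_steinerDiam_le (hn : 5 ≤ n) {G : SimpleGraph (Fin n)}
    (h : G.steinerDiam (n - 2) ≤ (n - 2 : ℕ)) (hdeg : ∀ v, (G.neighborSet v).ncard ≤ n - 2) :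
    n ≤ G.edgeSet.ncard := by
  have hG := connected_of_steinerDiam_le (by omega) h
  have he := hG.le_ncard_edgeSet
  by_contra! hlt
  have hpos : ∀ v, 1 ≤ (G.neighborSet v).ncard := by
    intro v
    have : Nontrivial (Fin n) := Fin.nontrivial_iff_two_le.2 (by omega)
    obtain ⟨w, hw⟩ := hG.preconnected.exists_adj_of_nontrivial v
    exact (Set.ncard_pos).2 ⟨w, hw⟩
  obtain ⟨x, hx⟩ : ∃ x, 2 ≤ (G.neighborSet x).ncard := by
    by_contra! hall
    have := Finset.sum_le_card_nsmul Finset.univ _ 1 fun v _ => Nat.le_of_lt_succ (hall v)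
    rw [sum_ncard_neighborSet] at this
    simp at this
    omega
  -- Otherwise the degree sum is at most `(n - 2) + (n - 1) < 2(n - 1)`; this is where the degree
  -- bound enters.
  obtain ⟨y, hyx, hy⟩ : ∃ y, y ≠ x ∧ 2 ≤ (G.neighborSet y).ncard := by
    by_contra! hall
    have := Finset.sum_le_card_nsmul (Finset.univ.erase x) _ 1 fun v hv =>
      Nat.le_of_lt_succ (hall v (Finset.ne_of_mem_erase hv))
    have h2 := sum_ncard_neighborSet (G := G)
    rw [← Finset.add_sum_erase _ _ (Finset.mem_univ x)] at h2
    rw [Finset.card_erase_of_mem (Finset.mem_univ x), Finset.card_univ, Fintype.card_fin] at this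
    simp at this
    have := hdeg x
    omega
  obtain ⟨H, hH, hS, hd⟩ := exists_connected_subgraph_avoiding (by omega) h hyx
  have hc := hH.ncard_verts_le
  have one : ∀ x y, (∀ v, v ≠ x → v ≠ y → v ∈ H.verts) → x ∉ H.verts → y ∈ H.verts →
      2 ≤ (G.neighborSet x).ncard → False := by
    intro x y hS hx hy h2
    have := Set.ncard_le_ncard (s := {x}ᶜ) (t := H.verts) fun v hv => by
      by_cases h : v = y
      · exact h ▸ hy
      · exact hS v hv h
    rw [Set.ncard_compl, Set.ncard_singleton, Nat.card_fin] at this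
    have := ncard_edgeSet_add_le_of_notMem H hx
    omega
  -- Containing both needs `n - 1` edges in `H`. Missing one gives at least `(n - 2) + 2` edges in
  -- `G`; missing both gives at least `(n - 3) + 2 + 2 - 1`.
  by_cases hxH : x ∈ H.verts <;> by_cases hyH : y ∈ H.verts
  · have := Set.ncard_le_ncard (s := Set.univ) (t := H.verts) fun v _ => by
      by_cases h : v = y
      · exact h ▸ hyH
      by_cases h' : v = x
      · exact h' ▸ hxH
      exact hS v h h'
    rw [Set.ncard_univ, Nat.card_fin] at this
    omega
  · exact one y x hS hyH hxH hy
  · exact one x y (fun v h h' => hS v h' h) hxH hyH hx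
  · have := Set.ncard_le_ncard (s := {x, y}ᶜ) (t := H.verts) fun v hv => by
      simp at hv; exact hS v hv.2 hv.1
    rw [Set.ncard_compl, Set.ncard_pair hyx.symm, Nat.card_fin] at this
    have := ncard_edgeSet_add_le_of_notMem_two H hyx hyH hxH
    omega

end LowerBounds

/-! ### Extremal graphs -/

section Constructions

variable {n : ℕ}

/-- The broom: a star with centre `0` and leaves `1, …, a`, the last of which starts a path
`a, …, n - 1`. -/
def broomRel (a u v : ℕ) : Prop := (u = 0 ∧ 1 ≤ v ∧ v ≤ a) ∨ (a ≤ u ∧ v = u + 1)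

def broomGraph (n a : ℕ) : SimpleGraph (Fin n) := .fromRel fun u v => broomRel a u v

/-- The broom together with an edge from the centre to the end of the handle. -/
def loopedBroomRel (n a u v : ℕ) : Prop := broomRel a u v ∨ (u = 0 ∧ v = n - 1)

def loopedBroomGraph (n a : ℕ) : SimpleGraph (Fin n) := .fromRel fun u v => loopedBroomRel n a u v

theorem broomGraph_adj {a : ℕ} {u v : Fin n} : (broomGraph n a).Adj u v ↔
    (u : ℕ) ≠ v ∧ (broomRel a u v ∨ broomRel a v u) := by
  simp [broomGraph, Fin.ext_iff]

theorem loopedBroomGraph_adj {a : ℕ} {u v : Fin n} : (loopedBroomGraph n a).Adj u v ↔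
    (u : ℕ) ≠ v ∧ (loopedBroomRel n a u v ∨ loopedBroomRel n a v u) := by
  simp [loopedBroomGraph, Fin.ext_iff]

theorem ncard_edgeSet_broomGraph_le {a : ℕ} :
    (broomGraph n a).edgeSet.ncard ≤ n - 1 := by
  refine (ncard_edgeSet_le ((Finset.Ico 1 n).image fun i => (if i ≤ a then 0 else i - 1, i)) ?_).trans
    (Finset.card_image_le.trans (by simp))
  intro u v h
  simp only [broomGraph_adj, broomRel] at h
  have := u.2
  have := v.2
  simp only [Finset.mem_image, Finset.mem_Ico, Prod.mk.injEq]
  rcases h with ⟨h0, h | h⟩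
  · refine .inl ⟨v, by omega, ?_, rfl⟩; split_ifs <;> omega
  · refine .inr ⟨u, by omega, ?_, rfl⟩; split_ifs <;> omega

theorem ncard_edgeSet_loopedBroomGraph_le {a : ℕ} (hn : 1 ≤ n) :
    (loopedBroomGraph n a).edgeSet.ncard ≤ n := by
  classical
  refine (ncard_edgeSet_le (insert (0, n - 1)
    ((Finset.Ico 1 n).image fun i => (if i ≤ a then 0 else i - 1, i))) ?_).trans
    ((Finset.card_insert_le _ _).trans (Nat.add_le_of_le_sub hn (Finset.card_image_le.trans (by simp))))
  intro u v h
  simp only [loopedBroomGraph_adj, loopedBroomRel, broomRel] at h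
  have := u.2
  have := v.2
  simp only [Finset.mem_insert, Finset.mem_image, Finset.mem_Ico, Prod.mk.injEq]
  rcases h with ⟨h0, (h | h) | (h | h)⟩
  · refine .inl (.inr ⟨v, by omega, ?_, rfl⟩); split_ifs <;> omega
  · exact .inl (.inl h)
  · refine .inr (.inr ⟨u, by omega, ?_, rfl⟩); split_ifs <;> omega
  · exact .inr (.inl h)

theorem ncard_neighborSet_broomGraph {a : ℕ} (ha : 2 ≤ a) (han : a ≤ n - 1) :
    (∀ v, ((broomGraph n a).neighborSet v).ncard ≤ a) ∧
      ∃ v, ((broomGraph n a).neighborSet v).ncard = a := by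
  have hz : ((broomGraph n a).neighborSet ⟨0, by omega⟩).ncard = a := by
    rw [ncard_neighborSet_eq (Finset.Icc 1 a) (by simp; omega)]
    · simp
    · intro w
      simp only [broomGraph_adj, broomRel, true_and, Finset.mem_Icc]
      omega
  refine ⟨fun v => ?_, _, hz⟩
  by_cases hv : (v : ℕ) = 0
  · rw [show v = ⟨0, by omega⟩ from Fin.ext hv, hz]
  refine (ncard_neighborSet_le ({if (v : ℕ) ≤ a then 0 else (v : ℕ) - 1, (v : ℕ) + 1} : Finset ℕ) fun w hw => ?_).trans
    (Finset.card_le_two.trans ha)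
  simp only [broomGraph_adj, broomRel] at hw
  simp only [Finset.mem_insert, Finset.mem_singleton]
  split_ifs <;> omega

theorem ncard_neighborSet_loopedBroomGraph {a : ℕ} (ha : 1 ≤ a) (han : a + 1 ≤ n - 1) :
    (∀ v, ((loopedBroomGraph n a).neighborSet v).ncard ≤ a + 1) ∧
      ∃ v, ((loopedBroomGraph n a).neighborSet v).ncard = a + 1 := by
  have hz : ((loopedBroomGraph n a).neighborSet ⟨0, by omega⟩).ncard = a + 1 := by
    rw [ncard_neighborSet_eq (insert (n - 1) (Finset.Icc 1 a))
      (by intro w hw; simp at hw; omega)]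
    · rw [Finset.card_insert_of_notMem (by simp; omega)]; simp
    · intro w
      simp only [loopedBroomGraph_adj, loopedBroomRel, broomRel, true_and, Finset.mem_insert, Finset.mem_Icc]
      omega
  refine ⟨fun v => ?_, _, hz⟩
  by_cases hv : (v : ℕ) = 0
  · rw [show v = ⟨0, by omega⟩ from Fin.ext hv, hz]
  refine (ncard_neighborSet_le ({if (v : ℕ) ≤ a then 0 else (v : ℕ) - 1,
    if (v : ℕ) = n - 1 then 0 else (v : ℕ) + 1} : Finset ℕ) fun w hw => ?_).trans
    (Finset.card_le_two.trans (by omega))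
  have := w.2
  simp only [loopedBroomGraph_adj, loopedBroomRel, broomRel] at hw
  simp only [Finset.mem_insert, Finset.mem_singleton]
  split_ifs <;> omega

theorem broomGraph_connected {a : ℕ} (hn : 1 ≤ n) :
    ((broomGraph n a).induce Set.univ).Connected := by
  refine ReachIn.connected 0 ⟨hn, trivial⟩ fun u _ => ?_
  have hu := u.2
  have star : ∀ v, v ≤ a → v < n → ReachIn (broomGraph n a) Set.univ v 0 := fun v hv hvn => by
    rcases Nat.eq_zero_or_pos v with rfl | hv0
    · exact .refl ⟨hn, trivial⟩
    · refine .of_adj ⟨hvn, trivial⟩ ⟨hn, trivial⟩ ?_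
      simp only [broomGraph_adj, broomRel, true_and]
      omega
  by_cases h : (u : ℕ) ≤ a
  · exact star u h hu
  · refine (ReachIn.of_interval (by omega) (fun i _ _ => ⟨by omega, Set.mem_univ _⟩)
      fun i _ _ _ => ?_).symm.trans (star a le_rfl (by omega))
    simp only [broomGraph_adj, broomRel, and_true]
    omega

theorem starGraph_connected_of_delete {x : Fin n} (hx : (x : ℕ) ≠ 0) :
    ((broomGraph n (n - 1)).induce {x}ᶜ).Connected := by
  have hx' := x.2
  have h0 : ∃ h : 0 < n, (⟨0, h⟩ : Fin n) ∈ ({x}ᶜ : Set (Fin n)) :=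
    ⟨by omega, by simp [Fin.ext_iff]; omega⟩
  refine ReachIn.connected 0 h0 fun u hu => ?_
  rcases Nat.eq_zero_or_pos (u : ℕ) with h | h
  · rw [h]; exact .refl h0
  · refine .of_adj ⟨u.2, hu⟩ h0 ?_
    have := u.2
    simp only [broomGraph_adj, broomRel, true_and]
    omega

/-- Each handle vertex can reach the centre from either end of the handle, and a single deletion
blocks only one way. -/
theorem loopedBroomGraph_connected_of_delete {a : ℕ} {x : Fin n} (hx : (x : ℕ) ≠ 0) :
    ((loopedBroomGraph n a).induce {x}ᶜ).Connected := by
  have hx' := x.2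
  have mem : ∀ i, i < n → i ≠ x → ∃ h : i < n, (⟨i, h⟩ : Fin n) ∈ ({x}ᶜ : Set (Fin n)) :=
    fun i h h' => ⟨h, by simpa [Fin.ext_iff] using h'⟩
  have h0 := mem 0 (by omega) hx.symm
  refine ReachIn.connected 0 h0 fun u hu => ?_
  have hux : (u : ℕ) ≠ x := fun h => hu (Fin.ext h)
  have hun := u.2
  have base : ∀ v, v ≤ a ∨ v = n - 1 → v < n → v ≠ x →
      ReachIn (loopedBroomGraph n a) {x}ᶜ v 0 := fun v hv hvn hvx => by
    rcases Nat.eq_zero_or_pos v with rfl | hv0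
    · exact .refl h0
    · refine .of_adj (mem v hvn hvx) h0 ?_
      simp only [loopedBroomGraph_adj, loopedBroomRel, broomRel, true_and]
      omega
  by_cases h : (u : ℕ) ≤ a
  · exact base u (.inl h) hun hux
  by_cases hxu : (x : ℕ) < u
  · refine (ReachIn.of_interval (by omega) (fun i _ _ => mem i (by omega) (by omega))
      fun i _ _ _ => ?_).trans (base (n - 1) (.inr rfl) (by omega) (by omega))
    simp only [loopedBroomGraph_adj, loopedBroomRel, broomRel, and_true]
    omega
  · refine (ReachIn.of_interval (by omega) (fun i _ _ => mem i (by omega) (by omega))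
      fun i _ _ _ => ?_).symm.trans (base a (.inl le_rfl) (by omega) (by omega))
    simp only [loopedBroomGraph_adj, loopedBroomRel, broomRel, and_true]
    omega

theorem steinerDiam_le_of_connected {k : ℕ} (hk : k ≠ 0) {G : SimpleGraph (Fin n)}
    (h : (G.induce Set.univ).Connected) : G.steinerDiam k ≤ (n - 1 : ℕ) :=
  (steinerDiam_le_iff hk).2 fun S _ => steinerDist_le_of_induce_connected (Set.subset_univ _) h
    (by rw [Set.ncard_univ, Nat.card_fin]; omega)

/-- If every vertex other than `0` is not a cut vertex, then any `n - 2` vertices are spanned by a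
tree with at most `n - 2` edges. -/
theorem steinerDiam_le_of_connected_delete (hn : 3 ≤ n) {G : SimpleGraph (Fin n)}
    (h : ∀ x : Fin n, (x : ℕ) ≠ 0 → (G.induce {x}ᶜ).Connected) :
    G.steinerDiam (n - 2) ≤ (n - 2 : ℕ) := by
  refine (steinerDiam_le_iff (by omega)).2 fun S hS => ?_
  have hc : Sᶜ.card = 2 := by rw [Finset.card_compl, Fintype.card_fin]; omega
  obtain ⟨x, hxS, hx⟩ : ∃ x ∈ Sᶜ, x ≠ ⟨0, by omega⟩ :=
    Finset.exists_mem_ne (by rw [hc]; exact Nat.one_lt_two) _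
  refine steinerDist_le_of_induce_connected (s := {x}ᶜ) ?_
    (h x fun h => hx (Fin.ext h)) ?_
  · rintro v hv rfl
    exact (Finset.mem_compl.1 hxS) hv
  · rw [Set.ncard_compl, Set.ncard_singleton, Nat.card_fin]; omega

theorem steinerDiam_le_of_connected_delete_two (hn : 3 ≤ n) {G : SimpleGraph (Fin n)}
    (h : ∀ x y : Fin n, x < y → (G.induce {x, y}ᶜ).Connected) :
    G.steinerDiam (n - 2) ≤ (n - 3 : ℕ) := by
  refine (steinerDiam_le_iff (by omega)).2 fun S hS => ?_
  have hc : Sᶜ.card = 2 := by rw [Finset.card_compl, Fintype.card_fin]; omega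
  obtain ⟨x, y, hxy, hSc⟩ := Finset.card_eq_two.1 hc
  have hS' : (S : Set (Fin n)) = {x, y}ᶜ := by
    rw [← compl_compl S, hSc, Finset.coe_compl, Finset.coe_pair]
  have hcard : (S : Set (Fin n)).ncard ≤ n - 3 + 1 := by rw [Set.ncard_coe_finset]; omega
  refine steinerDist_le_of_induce_connected subset_rfl ?_ hcard
  rw [hS']
  rcases lt_or_gt_of_ne hxy with hlt | hlt
  · exact h x y hlt
  · rw [Set.pair_comm]; exact h y x hlt

/-! A wheel-like graph: a rim `0, …, m - 1`, chords `a ~ p + 1 + a` for `a < p`, and a hub `m`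
joined to the rim vertices `p` and `c + 1, …, m - 1`. -/

def hubRel (m p c a b : ℕ) : Prop :=
  (a + 1 = b ∧ b < m) ∨ (a = m - 1 ∧ b = 0) ∨ (a < p ∧ b = p + 1 + a) ∨
    (a = m ∧ b < m ∧ (b = p ∨ c < b))

def hubGraph (n p c : ℕ) : SimpleGraph (Fin n) := .fromRel fun u v => hubRel (n - 1) p c u v

theorem hubGraph_adj {p c : ℕ} {u v : Fin n} : (hubGraph n p c).Adj u v ↔
    (u : ℕ) ≠ v ∧ (hubRel (n - 1) p c u v ∨ hubRel (n - 1) p c v u) := by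
  simp [hubGraph, Fin.ext_iff]

variable {p c : ℕ}

theorem ncard_edgeSet_hubGraph_le (hc : c + 5 ≤ n) :
    (hubGraph n p c).edgeSet.ncard ≤ (n - 1) + p + (n - 1 - c) := by
  classical
  refine (ncard_edgeSet_le
    (((Finset.range (n - 1)).image fun i => (i, if i = n - 2 then 0 else i + 1)) ∪
      ((Finset.range p).image fun i => (i, p + 1 + i)) ∪
      ((insert p (Finset.Ioo c (n - 1))).image fun i => (n - 1, i))) ?_).trans
    ((Finset.card_union_le _ _).trans (Nat.add_le_add ((Finset.card_union_le _ _).trans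
      (Nat.add_le_add (Finset.card_image_le.trans (by simp)) (Finset.card_image_le.trans (by simp))))
      (Finset.card_image_le.trans ((Finset.card_insert_le _ _).trans (by simp; omega)))))
  intro u v h
  simp only [hubGraph_adj, hubRel] at h
  simp only [Finset.mem_union, Finset.mem_image, Finset.mem_range, Finset.mem_insert,
    Finset.mem_Ioo, Prod.mk.injEq]
  have main : ∀ a b : ℕ, hubRel (n - 1) p c a b →
      ((∃ i < n - 1, i = a ∧ (if i = n - 2 then 0 else i + 1) = b) ∨
        ∃ i < p, i = a ∧ p + 1 + i = b) ∨
      ∃ i, (i = p ∨ c < i ∧ i < n - 1) ∧ n - 1 = a ∧ i = b := by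
    rintro a b (h | h | h | h)
    · refine .inl (.inl ⟨a, by omega, rfl, ?_⟩); split_ifs <;> omega
    · refine .inl (.inl ⟨a, by omega, rfl, ?_⟩); split_ifs <;> omega
    · exact .inl (.inr ⟨a, by omega, rfl, by omega⟩)
    · exact .inr ⟨b, by omega, by omega, rfl⟩
  exact h.2.imp (main u v) (main v u)

theorem ncard_neighborSet_hubGraph (hc : c + 5 ≤ n) (hp : 2 * p = c ∨ 2 * p = c + 1) :
    (∀ v, ((hubGraph n p c).neighborSet v).ncard ≤ n - 1 - c) ∧
      ∃ v, ((hubGraph n p c).neighborSet v).ncard = n - 1 - c := by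
  have hz : ((hubGraph n p c).neighborSet ⟨n - 1, by omega⟩).ncard = n - 1 - c := by
    rw [ncard_neighborSet_eq (insert p (Finset.Ioo c (n - 1)))
      (by intro w hw; simp at hw; omega)]
    · rw [Finset.card_insert_of_notMem (by simp; omega)]; simp; omega
    · intro w
      have := w.2
      simp only [hubGraph_adj, hubRel, true_and, Finset.mem_insert, Finset.mem_Ioo]
      omega
  refine ⟨fun v => ?_, _, hz⟩
  by_cases hv : (v : ℕ) = n - 1
  · rw [show v = ⟨n - 1, by omega⟩ from Fin.ext hv, hz]
  -- Two rim neighbours, at most one chord, and the hub. For `v = p` truncated subtraction lists a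
  -- spurious chord end, harmless since four candidates suffice.
  refine (ncard_neighborSet_le ({if (v : ℕ) = n - 2 then 0 else (v : ℕ) + 1,
    if (v : ℕ) = 0 then n - 2 else (v : ℕ) - 1, if (v : ℕ) < p then p + 1 + (v : ℕ) else (v : ℕ) - p - 1,
    n - 1} : Finset ℕ)
    fun w hw => ?_).trans (Finset.card_le_four.trans (by omega))
  have := w.2
  simp only [hubGraph_adj, hubRel] at hw
  simp only [Finset.mem_insert, Finset.mem_singleton]
  split_ifs <;> omega

/-- Two deleted rim vertices leave at most two arcs. An arc without spokes avoids `p` and everything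
above `c`, so it lies in `[0, p)` or `(p, c]`; the chords lead from each of these intervals across
`p`, hence into the other arc, which does have a spoke. -/
theorem hubGraph_connected_of_delete_two (hc : c + 5 ≤ n) (hp : 2 * p = c ∨ 2 * p = c + 1)
    {x y : Fin n} (hxy : x < y) : ((hubGraph n p c).induce {x, y}ᶜ).Connected := by
  have hyn := y.2
  have hxy' : (x : ℕ) < y := hxy
  have mem : ∀ i, i < n → i ≠ x → i ≠ y →
      ∃ h : i < n, (⟨i, h⟩ : Fin n) ∈ ({x, y}ᶜ : Set (Fin n)) :=
    fun i h h' h'' => ⟨h, by simp [Fin.ext_iff, h', h'']⟩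
  have adj : ∀ i j, i < n → j < n → i ≠ x → i ≠ y → j ≠ x → j ≠ y → hubRel (n - 1) p c i j → i ≠ j →
      ReachIn (hubGraph n p c) {x, y}ᶜ i j := fun i j hi hj h1 h2 h3 h4 h h5 =>
    .of_adj (mem i hi h1 h2) (mem j hj h3 h4) (hubGraph_adj.2 ⟨h5, .inl h⟩)
  have seg : ∀ i j, i ≤ j → j < n - 1 → (∀ k, i ≤ k → k ≤ j → k ≠ x ∧ k ≠ y) →
      ReachIn (hubGraph n p c) {x, y}ᶜ i j := fun i j hij hj h =>
    .of_interval hij (fun k h1 h2 => mem k (by omega) (h k h1 h2).1 (h k h1 h2).2)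
      fun k h1 h2 h3 => hubGraph_adj.2 ⟨by simp, .inl (.inl ⟨rfl, by simp; omega⟩)⟩
  have wrap : (x : ℕ) ≠ 0 → (y : ℕ) ≠ n - 2 → (x : ℕ) ≠ n - 2 →
      ReachIn (hubGraph n p c) {x, y}ᶜ (n - 2) 0 := fun h1 h2 h3 =>
    adj _ _ (by omega) (by omega) h3.symm (by omega) (by omega) (by omega)
      (.inr (.inl ⟨by omega, rfl⟩)) (by omega)
  generalize hX : (x : ℕ) = X at *
  generalize hY : (y : ℕ) = Y at *
  have toConn : ∀ r, r < n → r ≠ X → r ≠ Y → (∀ u, u < n → u ≠ X → u ≠ Y →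
      ReachIn (hubGraph n p c) {x, y}ᶜ u r) → ((hubGraph n p c).induce {x, y}ᶜ).Connected := by
    intro r h1 h2 h3 h
    refine ReachIn.connected r (mem r h1 h2 h3) fun u hu => h u u.2 ?_ ?_
    · intro e; exact hu (.inl (Fin.ext (e.trans hX.symm)))
    · intro e; exact hu (.inr (Fin.ext (e.trans hY.symm)))
  -- Without the hub, the rim minus one vertex is a path.
  by_cases hub : Y = n - 1
  · by_cases hX0 : X = 0
    · refine toConn (n - 2) (by omega) (by omega) (by omega) fun u h1 h2 h3 => ?_
      exact seg u (n - 2) (by omega) (by omega) fun k _ _ => by omega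
    · refine toConn 0 (by omega) (by omega) (by omega) fun u h1 h2 h3 => ?_
      rcases lt_or_gt_of_ne h2 with h | h
      · exact (seg 0 u (by omega) (by omega) fun k _ _ => by omega).symm
      · exact (seg u (n - 2) (by omega) (by omega) fun k _ _ => by omega).trans
          (wrap (by omega) (by omega) (by omega))
  have inner : ∀ u v, X < u → u < Y → X < v → v < Y → ReachIn (hubGraph n p c) {x, y}ᶜ u v := by
    intro u v h1 h2 h3 h4
    rcases le_total u v with h | h
    · exact seg u v h (by omega) fun k _ _ => by omega
    · exact (seg v u h (by omega) fun k _ _ => by omega).symm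
  have outer' : ∀ u v, u ≤ v → (u < X ∨ Y < u ∧ u < n - 1) → (v < X ∨ Y < v ∧ v < n - 1) →
      ReachIn (hubGraph n p c) {x, y}ᶜ u v := by
    intro u v h h1 h2
    by_cases huv : v < X ∨ Y < u
    · exact seg u v h (by omega) fun k _ _ => by omega
    · exact (((seg v (n - 2) (by omega) (by omega) fun k _ _ => by omega).trans
        (wrap (by omega) (by omega) (by omega))).trans
          (seg 0 u (by omega) (by omega) fun k _ _ => by omega)).symm
  have outer : ∀ u v, (u < X ∨ Y < u ∧ u < n - 1) → (v < X ∨ Y < v ∧ v < n - 1) →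
      ReachIn (hubGraph n p c) {x, y}ᶜ u v := fun u v h1 h2 =>
    (le_total u v).elim (fun h => outer' u v h h1 h2) fun h => (outer' v u h h2 h1).symm
  have spoke : ∀ v, v < n - 1 → v ≠ X → v ≠ Y → (v = p ∨ c < v) →
      ReachIn (hubGraph n p c) {x, y}ᶜ v (n - 1) := fun v h1 h2 h3 h4 =>
    (adj (n - 1) v (by omega) (by omega) (by omega) (by omega) h2 h3
      (.inr (.inr (.inr ⟨rfl, h1, h4⟩))) (by omega)).symm
  have chord : ∀ i, i < p → i ≠ X → i ≠ Y → p + 1 + i ≠ X → p + 1 + i ≠ Y →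
      ReachIn (hubGraph n p c) {x, y}ᶜ i (p + 1 + i) := fun i h1 h2 h3 h4 h5 =>
    adj _ _ (by omega) (by omega) h2 h3 h4 h5 (.inr (.inr (.inl ⟨h1, rfl⟩))) (by omega)
  refine toConn (n - 1) (by omega) (by omega) (by omega) fun u h1 h2 h3 => ?_
  by_cases hu : u = n - 1
  · rw [hu]; exact .refl (mem _ (by omega) (by omega) (by omega))
  by_cases hI : ∃ v, X < v ∧ v < Y ∧ (v = p ∨ c < v)
  · obtain ⟨v, hv1, hv2, hv3⟩ := hI
    have hin : ∀ w, X < w → w < Y → ReachIn (hubGraph n p c) {x, y}ᶜ w (n - 1) := fun w h h' =>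
      (inner w v h h' hv1 hv2).trans (spoke v (by omega) (by omega) (by omega) hv3)
    by_cases huI : X < u ∧ u < Y
    · exact hin u huI.1 huI.2
    by_cases hO : ∃ v, (v < X ∨ Y < v ∧ v < n - 1) ∧ (v = p ∨ c < v)
    · obtain ⟨w, hw1, hw2⟩ := hO
      exact (outer u w (by omega) hw1).trans (spoke w (by omega) (by omega) (by omega) hw2)
    -- No outer spoke forces `Y = n - 2` and `X ≤ p`, so the outer arc is `[0, X)` and its chords
    -- end in the inner arc.
    · push Not at hO
      have e1 := hO (n - 2)
      have e2 := hO u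
      have e3 := hO p
      have e4 := hO (c + 1)
      have hup : u < p := by omega
      exact (chord u hup (by omega) (by omega) (by omega) (by omega)).trans
        (hin _ (by omega) (by omega))
  · push Not at hI
    have e1 := hI (c + 1)
    have e2 := hI (c + 2)
    have e3 := hI p
    have hout : ∀ w, (w < X ∨ Y < w ∧ w < n - 1) →
        ReachIn (hubGraph n p c) {x, y}ᶜ w (n - 1) := by
      -- The hub has the four neighbours `p`, `c + 1`, `c + 2`, `n - 2`; at most two are deleted and
      -- none is in the inner arc.
      have : ∃ v, (v < X ∨ Y < v ∧ v < n - 1) ∧ (v = p ∨ c < v) := by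
        by_contra! hO
        have := hO (n - 2)
        have := hO (c + 1)
        have := hO (c + 2)
        have := hO p
        omega
      obtain ⟨v, hv1, hv2⟩ := this
      exact fun w hw => (outer w v hw hv1).trans (spoke v (by omega) (by omega) (by omega) hv2)
    by_cases huI : X < u ∧ u < Y
    · have e4 := hI u
      by_cases hup : u < p
      · exact (chord u hup (by omega) (by omega) (by omega) (by omega)).trans
          (hout _ (by omega))
      · have := chord (u - p - 1) (by omega) (by omega) (by omega) (by omega) (by omega)
        rw [show p + 1 + (u - p - 1) = u by omega] at this
        exact this.symm.trans (hout _ (by omega))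
    · exact hout u (by omega)

end Constructions

/-- The minimum size of a graph with given maximum degree any two of whose vertices can be removed
without disconnecting it. -/
theorem minSteinerSize_sub_three {n ℓ : ℕ} (hℓ : 4 ≤ ℓ) (hn : ℓ + 1 ≤ n) :
    minSteinerSize (n - 2) n ℓ (n - 3) = ((n - 1 + ℓ + (n - ℓ) / 2 : ℕ) : ℕ∞) := by
  have : NeZero n := ⟨by omega⟩
  -- Here `c = n - 1 - ℓ` counts the rim vertices without a spoke, and `p = ⌈c / 2⌉` chords cover
  -- them.
  refine minSteinerSize_eq (hubGraph n ((n - ℓ) / 2) (n - 1 - ℓ))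
    (mem_steinerClass_iff.2 ⟨?_, steinerDiam_le_of_connected_delete_two (by omega) fun x y h =>
      hubGraph_connected_of_delete_two (by omega) (by omega) h⟩)
    ((ncard_edgeSet_hubGraph_le (by omega)).trans (by omega)) fun G hG => ?_
  · have := ncard_neighborSet_hubGraph (n := n) (p := (n - ℓ) / 2) (c := n - 1 - ℓ)
      (by omega) (by omega)
    rwa [show n - 1 - (n - 1 - ℓ) = ℓ by omega] at this
  · obtain ⟨⟨-, v, hv⟩, hd⟩ := mem_steinerClass_iff.1 hG
    have := le_two_mul_ncard_edgeSet (three_le_ncard_neighborSet (by omega) hd) v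
    omega

/-! ### Values for the bounds `n - 1` and `n - 2`, and assembly -/

theorem minSteinerSize_sub_one {n ℓ : ℕ} (hℓ : 2 ≤ ℓ) (hn : ℓ ≤ n - 1) :
    minSteinerSize (n - 2) n ℓ (n - 1) = ((n - 1 : ℕ) : ℕ∞) := by
  have : NeZero n := ⟨by omega⟩
  refine minSteinerSize_eq (broomGraph n ℓ) (mem_steinerClass_iff.2
    ⟨ncard_neighborSet_broomGraph hℓ hn, steinerDiam_le_of_connected (by omega)
      (broomGraph_connected (by omega))⟩) ncard_edgeSet_broomGraph_le fun G hG => ?_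
  obtain ⟨⟨-, v, hv⟩, hd⟩ := mem_steinerClass_iff.1 hG
  by_cases h : 4 ≤ n
  · exact (connected_of_steinerDiam_le h hd).le_ncard_edgeSet
  -- Only `n = 3`, `ℓ = 2` remains, where the edges at `v` already suffice.
  · have := ncard_edgeSet_add_le_of_notMem (⊥ : G.Subgraph) (x := v) (by simp)
    omega

theorem minSteinerSize_sub_two_of_le {n ℓ : ℕ} (h5 : 5 ≤ n) (hℓ : 2 ≤ ℓ) (hn : ℓ ≤ n - 2) :
    minSteinerSize (n - 2) n ℓ (n - 2) = (n : ℕ∞) := by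
  have : NeZero n := ⟨by omega⟩
  refine minSteinerSize_eq (loopedBroomGraph n (ℓ - 1)) (mem_steinerClass_iff.2
    ⟨?_, steinerDiam_le_of_connected_delete (by omega) fun x hx =>
      loopedBroomGraph_connected_of_delete hx⟩)
    (ncard_edgeSet_loopedBroomGraph_le (by omega)) fun G hG => ?_
  · have := ncard_neighborSet_loopedBroomGraph (n := n) (a := ℓ - 1) (by omega) (by omega)
    rwa [show ℓ - 1 + 1 = ℓ by omega] at this
  · obtain ⟨⟨hle, -⟩, hd⟩ := mem_steinerClass_iff.1 hG
    exact le_ncard_edgeSet_of_steinerDiam_le h5 hd fun v => (hle v).trans hn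

theorem minSteinerSize_sub_two_star {n : ℕ} (h5 : 5 ≤ n) :
    minSteinerSize (n - 2) n (n - 1) (n - 2) = ((n - 1 : ℕ) : ℕ∞) := by
  have : NeZero n := ⟨by omega⟩
  refine minSteinerSize_eq (broomGraph n (n - 1)) (mem_steinerClass_iff.2
    ⟨ncard_neighborSet_broomGraph (by omega) le_rfl, steinerDiam_le_of_connected_delete (by omega)
      fun x hx => starGraph_connected_of_delete hx⟩) ncard_edgeSet_broomGraph_le fun G hG => ?_
  exact (connected_of_steinerDiam_le (by omega) (mem_steinerClass_iff.1 hG).2).le_ncard_edgeSet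

theorem mainTheorem2 :
    -- (1)
    (∀ n ℓ : ℕ, 2 ≤ ℓ → ℓ ≤ n - 1 →
      minSteinerSize (n - 2) n ℓ (n - 1) = ((n - 1 : ℕ) : ℕ∞)) ∧
    -- (2)
    (∀ n ℓ : ℕ, 5 ≤ n → 2 ≤ ℓ → ℓ ≤ n - 1 →
      (ℓ ≤ n - 2 → minSteinerSize (n - 2) n ℓ (n - 2) = (n : ℕ∞)) ∧
      (ℓ = n - 1 → minSteinerSize (n - 2) n ℓ (n - 2) = ((n - 1 : ℕ) : ℕ∞))) ∧
    -- (3), large maximum degree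
    (∀ n i : ℕ, i ≤ 1 →
      (5 + i ≤ n →
        minSteinerSize (n - 2) n (n - 1 - i) (n - 3) = ((2 * n - 2 : ℕ) : ℕ∞)) ∧
      (7 + 2 * i ≤ n →
        minSteinerSize (n - 2) n (n - 3 - i) (n - 3) = ((2 * n - 3 : ℕ) : ℕ∞)) ∧
      (11 + 2 * i ≤ n →
        minSteinerSize (n - 2) n (n - 5 - i) (n - 3) = ((2 * n - 4 : ℕ) : ℕ∞)) ∧
      (15 + 2 * i ≤ n →
        minSteinerSize (n - 2) n (n - 7 - i) (n - 3) = ((2 * n - 5 : ℕ) : ℕ∞))) ∧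
    -- (3), remaining maximum degrees
    (∀ n ℓ : ℕ, 6 ≤ ℓ → ℓ + 9 ≤ n →
      ∃ m : ℕ, minSteinerSize (n - 2) n ℓ (n - 3) = (m : ℕ∞) ∧
        (3 * (n : ℝ) + ℓ - 3) / 2 ≤ m ∧
        ∀ r s : ℕ, 1 ≤ r → 2 ≤ s → s ≤ 5 → 4 * r + ℓ + s + 3 = n →
          (m : ℝ) ≤ (3 * (n : ℝ) + ℓ + s - 5) / 2 ∧
          (s = 2 → (m : ℝ) = (3 * (n : ℝ) + ℓ - 3) / 2)) := by
  refine ⟨fun n ℓ => minSteinerSize_sub_one, fun n ℓ h5 hℓ hn =>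
    ⟨minSteinerSize_sub_two_of_le h5 hℓ, ?_⟩, fun n i hi => ⟨?_, ?_, ?_, ?_⟩, ?_⟩
  · rintro rfl
    exact minSteinerSize_sub_two_star h5
  iterate 4
    intro h
    rw [minSteinerSize_sub_three (by omega) (by omega)]
    congr 1
    omega
  · intro n ℓ hℓ hn
    refine ⟨_, minSteinerSize_sub_three (by omega) (by omega), ?_, fun r s hr hs hs' h => ⟨?_, ?_⟩⟩
    · have : 3 * n + ℓ ≤ 2 * (n - 1 + ℓ + (n - ℓ) / 2) + 3 := by omega
      have : 3 * (n : ℝ) + ℓ ≤ 2 * ((n - 1 + ℓ + (n - ℓ) / 2 : ℕ) : ℝ) + 3 := by exact_mod_cast this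
      linarith
    · have : 2 * (n - 1 + ℓ + (n - ℓ) / 2) + 5 ≤ 3 * n + ℓ + s := by omega
      have : 2 * ((n - 1 + ℓ + (n - ℓ) / 2 : ℕ) : ℝ) + 5 ≤ 3 * (n : ℝ) + ℓ + s := by
        exact_mod_cast this
      linarith
    · intro h2
      have : 2 * (n - 1 + ℓ + (n - ℓ) / 2) + 3 = 3 * n + ℓ := by omega
      have : 2 * ((n - 1 + ℓ + (n - ℓ) / 2 : ℕ) : ℝ) + 3 = 3 * (n : ℝ) + ℓ := by
        exact_mod_cast this
      linarith
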